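/- Let $n\ge 2$, let $S^{n-1}$ be the unit sphere of $\mathbb{R}^n$ with spherical Lebesgue measure $d\xi$, and let $\mathscr{K}_{(o)}^n$ be the set of compact convex sets $K\subset\mathbb{R}^n$ whose interiors contain the origin. For $K\in\mathscr{K}_{(o)}^n$ put $h_K(x)=\max\{x\cdot y:y\in K\}$, $\rho_K(x)=\max\{t\ge 0: tx\in K\}$ ($x\neq o$) and $K^*=\{x: x\cdot y\le 1 \text{ for all } y\in K\}$. For $\omega\subseteq S^{n-1}$ let $\pmb{\alpha}^*_K(\omega)$ be the set of all $x/|x|$ where $x\in\partial K$ satisfies $x\cdot v=h_K(v)$ for some $v\in\omega$. For $u\in S^{n-1}$ let $\alpha_K(u)$ be the unit vector $v$ with $\rho_K(u)\,u\cdot v=h_K(v)$, which is unique for $d\xi$-almost every $u$. Let $\mathcal{C}$ be the set of functions $G:S^{n-1}\times(0,\infty)\to\mathbb{R}$ such that $G$ and $G_t=\partial G/\partial t$ are continuous on $S^{n-1}\times(0,\infty)$. Let $\mathcal{C}_d$ be the set of $G\in\mathcal{C}$ with $G_t<0$ on $S^{n-1}\times(0,\infty)$, and let $\mathscr{G}_d$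 be the set of $G\in\mathcal{C}_d$ with $G>0$ such that $\lim_{t\to0^+}G(\xi,t)=\infty$ and $\lim_{t\to\infty}G(\xi,t)=0$ for each $\xi\in S^{n-1}$. For $\Theta=(G,\Psi,\lambda)$ and a Borel set $\omega\subseteq S^{n-1}$ put $$C_\Theta(K,\omega)=\int_{\pmb{\alpha}^*_K(\omega)}\frac{\rho_K(\xi)\,G_t(\xi,\rho_K(\xi))}{\rho_{K^*}(\alpha_K(\xi))\,\Psi_t\big(\alpha_K(\xi),\rho_{K^*}(\alpha_K(\xi))\big)}\,d\lambda(\xi).$$ Theorem. Let $\lambda$ and $\mu$ be nonzero finite Borel measures on $S^{n-1}$, neither concentrated on a closed hemisphere (that is, $\int_{S^{n-1}}\max\{u\cdot\xi,0\}\,d\lambda(\xi)>0$ and $\int_{S^{n-1}}\max\{u\cdot\xi,0\}\,d\mu(\xi)>0$ for every $u\in S^{n-1}$), with $\lambda$ absolutely continuous with respect to $d\xi$. Suppose that either (i) $\Psi\in\mathcal{C}_d$ satisfies $\lim_{t\to0^+}\Psi(\xi,t)=+\infty$ for each $\xi\in S^{n-1}$, and $G\in\mathscr{G}_d$; or (ii)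 $G\in\mathcal{C}_d$ satisfies $\lim_{t\to0^+}G(\xi,t)=+\infty$ for each $\xi\in S^{n-1}$, and $\Psi\in\mathscr{G}_d$. Then there exists $K\in\mathscr{K}_{(o)}^n$ such that $C_\Theta(K,S^{n-1})\neq 0$ and $$\frac{\mu(\omega)}{\mu(S^{n-1})}=\frac{C_\Theta(K,\omega)}{C_\Theta(K,S^{n-1})}\qquad\text{for every Borel set }\omega\subseteq S^{n-1}.$$ -/

import Mathlib

open MeasureTheory Set Filter Topology

noncomputable section

namespace MusielakOrlicz

/-- Euclidean space of dimension `n`. -/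
abbrev E (n : ℕ) : Type := EuclideanSpace ℝ (Fin n)

/-- The unit sphere of `n`-dimensional Euclidean space. -/
abbrev Sph (n : ℕ) : Type := Metric.sphere (0 : E n) 1

/-- The canonical spherical Lebesgue (surface area) measure on the unit sphere. -/
def sphericalMeasure (n : ℕ) : Measure (Sph n) := (volume : Measure (E n)).toSphere

/-- The convex bodies (compact convex sets) whose interiors contain the origin. -/
def convexBodiesO (n : ℕ) : Set (Set (E n)) :=
  {K | Convex ℝ K ∧ IsCompact K ∧ (0 : E n) ∈ interior K}

/-- The support function `h_K(x) = max {x · y : y ∈ K}`. -/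
def supportFun {n : ℕ} (K : Set (E n)) (x : E n) : ℝ :=
  sSup ((fun y : E n => inner ℝ x y) '' K)

/-- The radial function `ρ_K(x) = max {t ≥ 0 : t x ∈ K}`. -/
def radialFun {n : ℕ} (K : Set (E n)) (x : E n) : ℝ :=
  sSup {t : ℝ | 0 ≤ t ∧ t • x ∈ K}

/-- The polar body `K* = {x : x · y ≤ 1 for all y ∈ K}`. -/
def polarBody {n : ℕ} (K : Set (E n)) : Set (E n) :=
  {x | ∀ y ∈ K, inner ℝ x y ≤ 1}

/-- The (set-valued) Gauss map: all outer unit normals of `K` at the boundary point `x`. -/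
def gaussMap {n : ℕ} (K : Set (E n)) (x : E n) : Set (Sph n) :=
  {v | inner ℝ x (v : E n) = supportFun K v}

/-- The inverse Gauss map: all boundary points of `K` having `v` as outer unit normal. -/
def inverseGaussMap {n : ℕ} (K : Set (E n)) (v : Sph n) : Set (E n) :=
  {x | x ∈ frontier K ∧ inner ℝ x (v : E n) = supportFun K v}

/-- The radial map `r_K(u) = ρ_K(u) u`. -/
def radialMap {n : ℕ} (K : Set (E n)) (u : Sph n) : E n :=
  radialFun K u • (u : E n)

/-- The (set-valued) radial Gauss image of a direction: the outer unit normals of `K` at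
`ρ_K(u) u`. -/
def radialGaussImage {n : ℕ} (K : Set (E n)) (u : Sph n) : Set (Sph n) :=
  gaussMap K (radialMap K u)

/-- The reverse radial Gauss image of a set `ω` of directions: the radial projections
`x / |x|` of the boundary points `x` of `K` with an outer unit normal in `ω`. -/
def reverseRadialGaussImage {n : ℕ} (K : Set (E n)) (ω : Set (Sph n)) : Set (Sph n) :=
  {u | ∃ v ∈ ω, ∃ x ∈ inverseGaussMap K v, ‖x‖⁻¹ • x = (u : E n)}

/-- The single-valued radial Gauss map `α_K`. Wherever the radial Gauss image of `u` is a
singleton (for convex bodies containing the origin in the interior: almost everywhere with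
respect to the spherical measure) this is its unique element; elsewhere it is an arbitrary
element of the radial Gauss image. -/
def radialGaussMap {n : ℕ} (K : Set (E n)) (u : Sph n) : Sph n :=
  @Classical.epsilon (Sph n) ⟨u⟩ (fun v => v ∈ radialGaussImage K u)

/-- The class `𝒞` of functions `G` on `S^{n-1} × (0, ∞)` such that `G` and its partial derivative
`G_t` in the second variable (exist and) are continuous on `S^{n-1} × (0, ∞)`. The values of
`G ξ t` for `t ≤ 0` play no role. -/
structure ClassC {n : ℕ} (G : Sph n → ℝ → ℝ) : Prop where
  differentiableAt : ∀ ξ : Sph n, ∀ t : ℝ, 0 < t → DifferentiableAt ℝ (G ξ) t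
  continuousOn : ContinuousOn (fun p : Sph n × ℝ => G p.1 p.2) (univ ×ˢ Ioi 0)
  continuousOn_deriv :
    ContinuousOn (fun p : Sph n × ℝ => deriv (G p.1) p.2) (univ ×ˢ Ioi 0)

/-- The class `𝒞_d`: members of `𝒞` with `G_t < 0` everywhere. -/
structure ClassCd {n : ℕ} (G : Sph n → ℝ → ℝ) : Prop extends ClassC G where
  deriv_neg : ∀ ξ : Sph n, ∀ t : ℝ, 0 < t → deriv (G ξ) t < 0

/-- The growth condition `lim_{t → 0+} G(ξ, t) = +∞` for each `ξ`. -/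
def BlowsUpAtZero {n : ℕ} (G : Sph n → ℝ → ℝ) : Prop :=
  ∀ ξ : Sph n, Tendsto (G ξ) (𝓝[>] 0) atTop

/-- The class `𝒢_d`: strictly positive members of `𝒞` with `G_t < 0` everywhere, and with
`G(ξ, t) → ∞` as `t → 0+` and `G(ξ, t) → 0` as `t → ∞` for each `ξ`. -/
structure ClassGd {n : ℕ} (G : Sph n → ℝ → ℝ) : Prop extends ClassC G where
  pos : ∀ ξ : Sph n, ∀ t : ℝ, 0 < t → 0 < G ξ t
  deriv_neg : ∀ ξ : Sph n, ∀ t : ℝ, 0 < t → deriv (G ξ) t < 0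
  tendsto_zero : ∀ ξ : Sph n, Tendsto (G ξ) (𝓝[>] 0) atTop
  tendsto_atTop : ∀ ξ : Sph n, Tendsto (G ξ) atTop (𝓝 0)

/-- A (finite) Borel measure on the sphere is not concentrated on any closed hemisphere:
`∫ (u · ξ)_+ dμ(ξ) > 0` for every direction `u`. -/
def NotConcentratedOnHemisphere {n : ℕ} (μ : Measure (Sph n)) : Prop :=
  ∀ u : Sph n, 0 < ∫ ξ : Sph n, max (inner ℝ (u : E n) (ξ : E n)) 0 ∂μ

/-- The class `ℳ`: nonzero finite Borel measures on the sphere that are absolutely continuous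
with respect to the spherical Lebesgue measure. -/
structure ClassM {n : ℕ} (lam : Measure (Sph n)) : Prop where
  ne_zero : lam ≠ 0
  isFinite : IsFiniteMeasure lam
  absolutelyContinuous : lam ≪ sphericalMeasure n

/-- The integrand in the definition of the polar Musielak-Orlicz-Gauss image measure. -/
def polarDensity {n : ℕ} (G Ψ : Sph n → ℝ → ℝ) (K : Set (E n)) (ξ : Sph n) : ℝ :=
  (radialFun K ξ * deriv (G ξ) (radialFun K ξ)) /
    (radialFun (polarBody K) (radialGaussMap K ξ) *
      deriv (Ψ (radialGaussMap K ξ)) (radialFun (polarBody K) (radialGaussMap K ξ)))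

/-- The polar Musielak-Orlicz-Gauss image measure `C_Θ(K, ω)` of `K` for the triple
`Θ = (G, Ψ, lam)`, as a real-valued function of the Borel set `ω`. -/
def polarGaussImageMeasure {n : ℕ} (G Ψ : Sph n → ℝ → ℝ) (lam : Measure (Sph n))
    (K : Set (E n)) (ω : Set (Sph n)) : ℝ :=
  ∫ ξ in reverseRadialGaussImage K ω, polarDensity G Ψ K ξ ∂lam

end MusielakOrlicz

end

namespace MusielakOrlicz

variable {n : ℕ}

section

/-! ### The logarithmic polar transform -/

/-! A body is encoded by the continuous function `k = log h_K`. Then `polarLog k` is `-log ρ_K`, and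
the functions fixed by the double transform are exactly the logarithms of support functions. Under
`t = exp (-s)` the decreasing functions `G`, `Ψ` become increasing kernels, and two energies arise:
`A k = ∫ G(ξ, ρ_K) dλ`, which depends on `polarLog k`, and `B k = ∫ Ψ(v, ρ_{K*}) dμ`, which depends
on `k`.

The solution is a critical point of a combination of `A` and `B`. The double transform lowers `k`
and preserves `polarLog k`, so it increases neither energy; a minimum over all continuous functions
can therefore be sought among fixed points, where bounded sets are compact
(`isCompact_polarLog_fixed`). Let `P` be the energy with positive kernel and `Q` the other. Bounds
on `P` and `Q` bound `k` above and below (`exists_bound_of_energy_le`), so `Q + 1 / (c - P)` has a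
minimiser on `P < c`. The barrier replaces a constraint and its multiplier rule, and yields a
positive multiplier (`exists_critical_point`).

By Rademacher's theorem almost every `ξ` has a single contact direction `α ξ`, and there the
variation of `polarLog k` along `φ` is `-φ (α ξ)` (`hasDerivAt_polarLog`). The Euler-Lagrange
equation then says that `μ` is a constant multiple of the image under `α` of the weighted measure
`λ`, which is `C_Θ(K, ·)`; normalising removes the constant. -/

/-- The gauge of the Wulff shape `{x | ∀ v, x · v ≤ exp (k v)}`. -/
noncomputable def polarGauge (k : C(Sph n, ℝ)) (x : E n) : ℝ :=
  ⨆ v : Sph n, inner ℝ x (v : E n) * Real.exp (-k v)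

lemma continuous_inner_mul_exp (k : C(Sph n, ℝ)) (x : E n) :
    Continuous fun v : Sph n => inner ℝ x (v : E n) * Real.exp (-k v) := by
  fun_prop

lemma le_polarGauge (k : C(Sph n, ℝ)) (x : E n) (v : Sph n) :
    inner ℝ x (v : E n) * Real.exp (-k v) ≤ polarGauge k x :=
  le_ciSup (isCompact_range (continuous_inner_mul_exp k x)).bddAbove v

lemma norm_sph (v : Sph n) : ‖(v : E n)‖ = 1 := norm_eq_of_mem_sphere v

lemma exp_neg_le (k : C(Sph n, ℝ)) (v : Sph n) : Real.exp (-k v) ≤ Real.exp ‖k‖ :=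
  Real.exp_le_exp.2 ((neg_le_abs _).trans (k.norm_coe_le_norm v))

lemma inner_sph_le_one (ξ v : Sph n) : inner ℝ (ξ : E n) (v : E n) ≤ 1 := by
  simpa [norm_sph] using real_inner_le_norm (ξ : E n) (v : E n)

lemma inner_self_sph (v : Sph n) : inner ℝ (v : E n) (v : E n) = (1 : ℝ) := by
  rw [real_inner_self_eq_norm_sq, norm_sph, one_pow]

lemma exp_neg_norm_le_polarGauge (k : C(Sph n, ℝ)) (ξ : Sph n) :
    Real.exp (-‖k‖) ≤ polarGauge k ξ := by
  refine le_trans ?_ (le_polarGauge k ξ ξ)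
  rw [inner_self_sph, one_mul]
  exact Real.exp_le_exp.2 (neg_le_neg ((le_abs_self _).trans (k.norm_coe_le_norm ξ)))

lemma polarGauge_pos (k : C(Sph n, ℝ)) (ξ : Sph n) : 0 < polarGauge k ξ :=
  (Real.exp_pos _).trans_le (exp_neg_norm_le_polarGauge k ξ)

variable [Nonempty (Sph n)]

lemma exists_eq_polarGauge (k : C(Sph n, ℝ)) (x : E n) :
    ∃ v : Sph n, inner ℝ x (v : E n) * Real.exp (-k v) = polarGauge k x := by
  obtain ⟨v, -, hv⟩ := isCompact_univ.exists_isMaxOn univ_nonempty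
    (continuous_inner_mul_exp k x).continuousOn
  exact ⟨v, le_antisymm (le_polarGauge k x v) (ciSup_le fun w => hv (mem_univ w))⟩

lemma lipschitzWith_polarGauge (k : C(Sph n, ℝ)) :
    LipschitzWith (Real.exp ‖k‖).toNNReal (polarGauge k) := by
  refine LipschitzWith.of_le_add_mul _ fun x y => ?_
  rw [Real.coe_toNNReal _ (Real.exp_pos _).le]
  obtain ⟨v, hv⟩ := exists_eq_polarGauge k x
  have h1 := le_polarGauge k y v
  have h2 : inner ℝ (x - y) (v : E n) ≤ dist x y := by
    simpa [dist_eq_norm, norm_sph] using real_inner_le_norm (x - y) (v : E n)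
  rw [← hv]
  have h3 : inner ℝ (x - y) (v : E n) * Real.exp (-k v) ≤ dist x y * Real.exp ‖k‖ :=
    mul_le_mul h2 (exp_neg_le k v) (Real.exp_pos _).le dist_nonneg
  rw [inner_sub_left] at h3
  linarith

/-- The logarithmic polar transform `ξ ↦ max_v (log (ξ · v) - k v)`. -/
noncomputable def polarLog (k : C(Sph n, ℝ)) : C(Sph n, ℝ) where
  toFun ξ := Real.log (polarGauge k ξ)
  continuous_toFun :=
    ((lipschitzWith_polarGauge k).continuous.comp continuous_subtype_val).log
      fun ξ => (polarGauge_pos k ξ).ne'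

lemma polarLog_apply (k : C(Sph n, ℝ)) (ξ : Sph n) :
    polarLog k ξ = Real.log (polarGauge k ξ) := rfl

lemma exp_polarLog (k : C(Sph n, ℝ)) (ξ : Sph n) :
    Real.exp (polarLog k ξ) = polarGauge k ξ :=
  Real.exp_log (polarGauge_pos k ξ)

lemma inner_le_exp (k : C(Sph n, ℝ)) (ξ v : Sph n) :
    inner ℝ (ξ : E n) (v : E n) ≤ Real.exp (polarLog k ξ + k v) := by
  rw [Real.exp_add, exp_polarLog]
  have := mul_le_mul_of_nonneg_right (le_polarGauge k ξ v) (Real.exp_pos (k v)).le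
  rwa [mul_assoc, ← Real.exp_add, neg_add_cancel, Real.exp_zero, mul_one] at this

/-- The directions at which the maximum defining `polarLog k ξ` is attained. -/
def contactSet (k : C(Sph n, ℝ)) (ξ : Sph n) : Set (Sph n) :=
  {v | inner ℝ (ξ : E n) (v : E n) = Real.exp (polarLog k ξ + k v)}

lemma mem_contactSet {k : C(Sph n, ℝ)} {ξ v : Sph n} :
    v ∈ contactSet k ξ ↔ inner ℝ (ξ : E n) (v : E n) = Real.exp (polarLog k ξ + k v) := Iff.rfl

lemma contactSet_nonempty (k : C(Sph n, ℝ)) (ξ : Sph n) : (contactSet k ξ).Nonempty := by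
  obtain ⟨v, hv⟩ := exists_eq_polarGauge k ξ
  refine ⟨v, ?_⟩
  rw [mem_contactSet, Real.exp_add, exp_polarLog, ← hv, mul_assoc, ← Real.exp_add,
    neg_add_cancel, Real.exp_zero, mul_one]

/-- A direction optimal for `k` is only a competitor for `j`. This comparison drives the
monotonicity, the Lipschitz bound and the derivative of the transform. -/
lemma add_le_add_of_mem_contactSet {k : C(Sph n, ℝ)} {ξ v : Sph n} (hv : v ∈ contactSet k ξ)
    (j : C(Sph n, ℝ)) : polarLog k ξ + k v ≤ polarLog j ξ + j v :=
  Real.exp_le_exp.1 (mem_contactSet.1 hv ▸ inner_le_exp j ξ v)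

lemma polarLog_add_nonneg (k : C(Sph n, ℝ)) (ξ : Sph n) : 0 ≤ polarLog k ξ + k ξ := by
  have := inner_le_exp k ξ ξ
  rwa [inner_self_sph, Real.one_le_exp_iff] at this

lemma polarLog_antitone {j k : C(Sph n, ℝ)} (h : j ≤ k) : polarLog k ≤ polarLog j := by
  refine ContinuousMap.le_def.2 fun ξ => ?_
  obtain ⟨v, hv⟩ := contactSet_nonempty k ξ
  have := add_le_add_of_mem_contactSet hv j
  have := ContinuousMap.le_def.1 h v
  linarith

lemma polarLog_polarLog_le (k : C(Sph n, ℝ)) : polarLog (polarLog k) ≤ k := by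
  refine ContinuousMap.le_def.2 fun v => ?_
  obtain ⟨ξ, hξ⟩ := contactSet_nonempty (polarLog k) v
  have h := mem_contactSet.1 hξ ▸ (real_inner_comm (v : E n) (ξ : E n)) ▸ inner_le_exp k ξ v
  have := Real.exp_le_exp.1 h
  linarith

lemma polarLog_polarLog_polarLog (k : C(Sph n, ℝ)) :
    polarLog (polarLog (polarLog k)) = polarLog k :=
  le_antisymm (polarLog_polarLog_le _) (polarLog_antitone (polarLog_polarLog_le k))

lemma abs_polarLog_sub_le (j k : C(Sph n, ℝ)) (ξ : Sph n) :
    |polarLog j ξ - polarLog k ξ| ≤ ‖j - k‖ := by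
  have key : ∀ j k : C(Sph n, ℝ), polarLog j ξ - polarLog k ξ ≤ ‖j - k‖ := by
    intro j k
    obtain ⟨v, hv⟩ := contactSet_nonempty j ξ
    have h1 := add_le_add_of_mem_contactSet hv k
    have h2 := (neg_le_abs _).trans ((j - k).norm_coe_le_norm v)
    rw [ContinuousMap.sub_apply] at h2
    linarith
  exact abs_sub_le_iff.2 ⟨key j k, norm_sub_rev k j ▸ key k j⟩

lemma lipschitzWith_polarLog : LipschitzWith 1 (polarLog : C(Sph n, ℝ) → C(Sph n, ℝ)) := by
  refine LipschitzWith.of_dist_le_mul fun j k => ?_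
  rw [NNReal.coe_one, one_mul, dist_eq_norm, dist_eq_norm,
    ContinuousMap.norm_le _ (norm_nonneg _)]
  exact abs_polarLog_sub_le j k

lemma continuous_polarLog : Continuous (polarLog : C(Sph n, ℝ) → C(Sph n, ℝ)) :=
  lipschitzWith_polarLog.continuous

lemma norm_polarLog_le (k : C(Sph n, ℝ)) : ‖polarLog k‖ ≤ ‖k‖ := by
  rw [ContinuousMap.norm_le _ (norm_nonneg _)]
  intro ξ
  rw [Real.norm_eq_abs, abs_le]
  have hk := fun v => abs_le.1 (k.norm_coe_le_norm v)
  constructor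
  · linarith [polarLog_add_nonneg k ξ, (hk ξ).2]
  · obtain ⟨v, hv⟩ := contactSet_nonempty k ξ
    have := Real.exp_le_one_iff.1 (mem_contactSet.1 hv ▸ inner_sph_le_one ξ v)
    linarith [(hk v).1]

/-- The gauge is `exp ‖k‖`-Lipschitz and at least `exp (-‖k‖)` on the sphere, so its logarithm has a
Lipschitz constant depending only on `‖k‖`. This supplies equicontinuity. -/
lemma polarLog_sub_le (k : C(Sph n, ℝ)) (x y : Sph n) :
    polarLog k x - polarLog k y ≤ Real.exp ‖k‖ * (Real.exp ‖k‖ * dist x y) := by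
  rw [polarLog_apply, polarLog_apply]
  have hx := polarGauge_pos k x
  have hy := polarGauge_pos k y
  have hlip := (lipschitzWith_polarGauge k).dist_le_mul x y
  rw [Real.coe_toNNReal _ (Real.exp_pos _).le, Real.dist_eq] at hlip
  rw [← Real.log_div hx.ne' hy.ne']
  refine (Real.log_le_sub_one_of_pos (div_pos hx hy)).trans ?_
  rw [div_sub_one hy.ne', div_le_iff₀ hy]
  refine (le_abs_self _).trans (hlip.trans ?_)
  have h0 : 0 ≤ dist (x : E n) y := dist_nonneg
  calc Real.exp ‖k‖ * dist (x : E n) y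
      = Real.exp ‖k‖ * (Real.exp ‖k‖ * dist (x : E n) y) * Real.exp (-‖k‖) := by
        rw [Real.exp_neg]; field_simp
    _ ≤ _ := mul_le_mul_of_nonneg_left (exp_neg_norm_le_polarGauge k y) (by positivity)

/-- The fixed points of the double polar transform in a ball form a compact set. -/
lemma isCompact_polarLog_fixed (R : ℝ) :
    IsCompact {k : C(Sph n, ℝ) | polarLog (polarLog k) = k ∧ ‖k‖ ≤ R} := by
  set A := {k : C(Sph n, ℝ) | polarLog (polarLog k) = k ∧ ‖k‖ ≤ R} with hA
  have hclosed : IsClosed A :=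
    (isClosed_eq (continuous_polarLog.comp continuous_polarLog) continuous_id).inter
      (isClosed_le continuous_norm continuous_const)
  let e := ContinuousMap.isometryEquivBoundedOfCompact (Sph n) ℝ
  have hc : IsCompact (e '' A) := by
    refine BoundedContinuousFunction.arzela_ascoli₂ (Icc (-R) R) isCompact_Icc _
      (e.toHomeomorph.isClosedMap _ hclosed) ?_ ?_
    · rintro _ x ⟨k, hk, rfl⟩
      exact abs_le.1 ((k.norm_coe_le_norm x).trans hk.2)
    · refine Metric.equicontinuous_of_continuity_modulus
        (fun d => Real.exp R * (Real.exp R * d)) ?_ _ ?_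
      · have : Continuous fun d : ℝ => Real.exp R * (Real.exp R * d) := by fun_prop
        simpa using this.tendsto 0
      · rintro x y ⟨_, k, hk, rfl⟩
        change dist (k x) (k y) ≤ _
        have hj : ‖polarLog k‖ ≤ R := (norm_polarLog_le k).trans hk.2
        have key : ∀ x y : Sph n, k x - k y ≤ Real.exp R * (Real.exp R * dist x y) := by
          intro x y
          -- A fixed point is the transform of `polarLog k`, so it inherits the uniform modulus.
          have h := polarLog_sub_le (polarLog k) x y
          rw [hk.1] at h
          have hd : 0 ≤ dist x y := dist_nonneg
          refine h.trans ?_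
          gcongr
        rw [Real.dist_eq]
        exact abs_sub_le_iff.2 ⟨key x y, dist_comm x y ▸ key y x⟩
  have := hc.image e.symm.continuous
  rwa [← image_comp, show (e.symm ∘ e) = id from funext fun x => e.symm_apply_apply x,
    image_id] at this

end

section

/-! ### Energies with an increasing kernel -/

/-- A continuous kernel `Θ v s` with continuous positive derivative `Θ' v s` in `s`. -/
structure IncreasingKernel (Θ Θ' : Sph n → ℝ → ℝ) : Prop where
  continuous : Continuous fun p : Sph n × ℝ => Θ p.1 p.2
  continuous_deriv : Continuous fun p : Sph n × ℝ => Θ' p.1 p.2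
  hasDerivAt : ∀ v s, HasDerivAt (Θ v) (Θ' v s) s
  deriv_pos : ∀ v s, 0 < Θ' v s

lemma IncreasingKernel.monotone {Θ Θ' : Sph n → ℝ → ℝ} (h : IncreasingKernel Θ Θ') (v : Sph n) :
    Monotone (Θ v) :=
  monotone_of_hasDerivAt_nonneg (h.hasDerivAt v) fun s => (h.deriv_pos v s).le

lemma exists_abs_le_of_continuous {Θ : Sph n → ℝ → ℝ}
    (h : Continuous fun p : Sph n × ℝ => Θ p.1 p.2) (R : ℝ) :
    ∃ C, 0 ≤ C ∧ ∀ v s, |s| ≤ R → |Θ v s| ≤ C := by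
  obtain ⟨C, hC⟩ := (isCompact_univ.prod (isCompact_Icc (a := -R) (b := R))).exists_bound_of_continuousOn
    h.continuousOn
  exact ⟨max C 0, le_max_right _ _, fun v s hs =>
    (hC (v, s) ⟨mem_univ _, abs_le.1 hs⟩).trans (le_max_left _ _)⟩

/-- The integral of `Θ v (k v)` against `ν`. -/
noncomputable def energy (ν : Measure (Sph n)) (Θ : Sph n → ℝ → ℝ) (k : C(Sph n, ℝ)) : ℝ :=
  ∫ v, Θ v (k v) ∂ν

section

variable {ν : Measure (Sph n)} [IsFiniteMeasure ν] {Θ Θ' : Sph n → ℝ → ℝ}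

lemma continuous_kernel_comp (h : Continuous fun p : Sph n × ℝ => Θ p.1 p.2)
    (k : C(Sph n, ℝ)) : Continuous fun v => Θ v (k v) :=
  h.comp (continuous_id.prodMk k.continuous)

lemma integrable_of_continuous {f : Sph n → ℝ} (hf : Continuous f) : Integrable f ν :=
  hf.integrable_of_hasCompactSupport (HasCompactSupport.of_compactSpace f)

lemma continuous_energy (h : Continuous fun p : Sph n × ℝ => Θ p.1 p.2) :
    Continuous (energy ν Θ) := by
  refine continuous_iff_continuousAt.2 fun k => ?_
  obtain ⟨C, -, hC⟩ := exists_abs_le_of_continuous h (‖k‖ + 1)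
  refine continuousAt_of_dominated (bound := fun _ => C)
    (Eventually.of_forall fun j => (continuous_kernel_comp h j).aestronglyMeasurable)
    ?_ (integrable_const C) (Eventually.of_forall fun v => ?_)
  · filter_upwards [Metric.ball_mem_nhds k one_pos] with j hj
    refine Eventually.of_forall fun v => hC v _ ?_
    rw [mem_ball_iff_norm] at hj
    have h1 := j.norm_coe_le_norm v
    have h2 := norm_le_norm_add_norm_sub' j k
    rw [Real.norm_eq_abs] at h1
    linarith
  · have : Continuous fun j : C(Sph n, ℝ) => Θ v (j v) :=
      h.comp (continuous_const.prodMk (continuous_eval_const v))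
    exact this.continuousAt

lemma energy_mono (h : IncreasingKernel Θ Θ') {j k : C(Sph n, ℝ)} (hjk : j ≤ k) :
    energy ν Θ j ≤ energy ν Θ k :=
  integral_mono (integrable_of_continuous (continuous_kernel_comp h.continuous j))
    (integrable_of_continuous (continuous_kernel_comp h.continuous k))
    fun v => h.monotone v (ContinuousMap.le_def.1 hjk v)

/-- The hemisphere integral is continuous in the direction, so its minimum `m` over the compact
sphere is positive. With `δ` so small that the complement of a cap contributes at most `m / 2`,
every cap has mass at least `m / 2`. -/
lemma exists_measure_cap_ge [Nonempty (Sph n)] (hν : NotConcentratedOnHemisphere ν) :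
    ∃ δ > 0, ∃ η > 0, ∀ ξ : Sph n, η ≤ ν.real {v : Sph n | δ ≤ inner ℝ (ξ : E n) (v : E n)} := by
  have hc : Continuous fun ξ : Sph n => ∫ v : Sph n, max (inner ℝ (ξ : E n) (v : E n)) 0 ∂ν := by
    refine continuous_of_dominated (bound := fun _ => 1)
      (fun ξ => Continuous.aestronglyMeasurable (by fun_prop))
      (fun ξ => Eventually.of_forall fun v => ?_) (integrable_const _)
      (Eventually.of_forall fun v => by fun_prop)
    rw [Real.norm_eq_abs, abs_of_nonneg (le_max_right _ _)]
    exact max_le (inner_sph_le_one ξ v) zero_le_one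
  obtain ⟨ξ₀, -, h₀⟩ := isCompact_univ.exists_isMinOn univ_nonempty hc.continuousOn
  set m := ∫ v : Sph n, max (inner ℝ (ξ₀ : E n) (v : E n)) 0 ∂ν with hm
  have hm0 : 0 < m := hν ξ₀
  have hU : 0 ≤ ν.real univ := measureReal_nonneg
  have hδ : 0 < m / (2 * (ν.real univ + 1)) := by positivity
  refine ⟨_, hδ, m / 2, half_pos hm0, fun ξ => ?_⟩
  set δ := m / (2 * (ν.real univ + 1)) with hδdef
  have hA : MeasurableSet {v : Sph n | δ ≤ inner ℝ (ξ : E n) (v : E n)} :=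
    (isClosed_le continuous_const (by fun_prop)).measurableSet
  set A := {v : Sph n | δ ≤ inner ℝ (ξ : E n) (v : E n)}
  have h1 : m ≤ ∫ v, (δ + A.indicator (fun _ => (1 : ℝ)) v) ∂ν := by
    refine (h₀ (mem_univ ξ)).trans (integral_mono (integrable_of_continuous (by fun_prop))
      ((integrable_const _).add ((integrable_const (1 : ℝ)).indicator hA)) fun v => ?_)
    by_cases hv : v ∈ A
    · rw [indicator_of_mem hv]
      exact max_le ((inner_sph_le_one ξ v).trans (by linarith)) (by linarith)
    · rw [indicator_of_notMem hv, add_zero]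
      exact max_le (not_le.1 hv).le hδ.le
  rw [integral_add (integrable_const _) ((integrable_const (1 : ℝ)).indicator hA),
    integral_const, integral_indicator_const _ hA, smul_eq_mul, smul_eq_mul, mul_one] at h1
  have h2 : ν.real univ * δ ≤ m / 2 := by
    rw [hδdef, mul_div_assoc', div_le_div_iff₀ (by positivity) two_pos]
    nlinarith
  linarith

/-- Monotonicity in `s` upgrades pointwise divergence to uniform divergence, by a Dini-type
compactness argument. -/
lemma exists_forall_ge_of_tendsto [Nonempty (Sph n)] (h : IncreasingKernel Θ Θ')
    (hb : ∀ v, Tendsto (Θ v) atTop atTop) (M : ℝ) :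
    ∃ s₀, ∀ v s, s₀ ≤ s → M ≤ Θ v s := by
  have hopen : ∀ i : ℝ, IsOpen {v : Sph n | M < Θ v i} := fun i =>
    isOpen_lt continuous_const (h.continuous.comp (continuous_id.prodMk continuous_const))
  obtain ⟨i, hi⟩ := isCompact_univ.elim_directed_cover (fun i : ℝ => {v : Sph n | M < Θ v i}) hopen
    (fun v _ => mem_iUnion.2 ((hb v).eventually_gt_atTop M).exists)
    (Monotone.directed_le fun i j hij v hv => hv.trans_le (h.monotone v hij))
  exact ⟨i, fun v s hs => (hi (mem_univ v)).le.trans (h.monotone v hs)⟩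

/-- Coercivity of the energy on fixed points of the double polar transform. -/
lemma exists_forall_le_of_energy_le [Nonempty (Sph n)] (hν : NotConcentratedOnHemisphere ν)
    (h : IncreasingKernel Θ Θ') (hb : ∀ v, Tendsto (Θ v) atTop atTop) (c C : ℝ) :
    ∃ R, ∀ k : C(Sph n, ℝ), polarLog (polarLog k) = k → energy ν Θ k ≤ c →
      (∀ v, -C ≤ Θ v (k v)) → ∀ v, k v ≤ R := by
  obtain ⟨δ, hδ, η, hη, hcap⟩ := exists_measure_cap_ge hν
  obtain ⟨s₀, hs₀⟩ := exists_forall_ge_of_tendsto h hb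
    ((|c| + |C| * ν.real univ + 1) / η)
  set M := (|c| + |C| * ν.real univ + 1) / η with hM
  have hM0 : 0 ≤ M := by positivity
  refine ⟨s₀ - Real.log δ, fun k hk hkc hkC u => ?_⟩
  by_contra! hu
  -- A large support value in direction `u` is attained along some `ξ`, so the body reaches far in
  -- direction `ξ`. Then `k` is large on the whole cap around `ξ`, and `M` was chosen so that this
  -- mass alone pushes the energy above `c`.
  obtain ⟨ξ, hξ⟩ := contactSet_nonempty (polarLog k) u
  rw [mem_contactSet, hk] at hξ
  have h1 : k u + polarLog k ξ ≤ 0 := Real.exp_le_one_iff.1 (hξ ▸ inner_sph_le_one u ξ)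
  have hA : MeasurableSet {v : Sph n | δ ≤ inner ℝ (ξ : E n) (v : E n)} :=
    (isClosed_le continuous_const (by fun_prop)).measurableSet
  have h2 := hcap ξ
  set A := {v : Sph n | δ ≤ inner ℝ (ξ : E n) (v : E n)}
  have hI : Integrable (A.indicator fun _ => M) ν := (integrable_const M).indicator hA
  have h3 : ∫ v, (A.indicator (fun _ => M) v - |C|) ∂ν ≤ energy ν Θ k := by
    refine integral_mono (hI.sub (integrable_const _))
      (integrable_of_continuous (continuous_kernel_comp h.continuous k)) fun v => ?_
    have hC := (neg_le_neg (le_abs_self C)).trans (hkC v)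
    by_cases hv : v ∈ A
    · have h4 : Real.log δ ≤ polarLog k ξ + k v :=
        (Real.log_le_iff_le_exp hδ).2 (le_trans hv (inner_le_exp k ξ v))
      have h5 := hs₀ v (k v) (by linarith)
      simp only [indicator_of_mem hv]
      linarith [abs_nonneg C]
    · simp only [indicator_of_notMem hv]
      linarith
  rw [integral_sub hI (integrable_const _), integral_indicator_const _ hA, integral_const,
    smul_eq_mul, smul_eq_mul] at h3
  have h6 : η * M = |c| + |C| * ν.real univ + 1 := by rw [hM]; field_simp
  have h7 : η * M ≤ ν.real A * M := mul_le_mul_of_nonneg_right h2 hM0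
  linarith [le_abs_self c]

/-- Differentiation of the energy along a Lipschitz path. -/
lemma hasDerivAt_energy (h : IncreasingKernel Θ Θ') {p : ℝ → C(Sph n, ℝ)} {L : ℝ}
    (hL : ∀ s t, ‖p s - p t‖ ≤ L * |s - t|) {ψ : Sph n → ℝ} (hψ : AEStronglyMeasurable ψ ν)
    (hd : ∀ᵐ v ∂ν, HasDerivAt (fun t => p t v) (ψ v) 0) :
    HasDerivAt (fun t => energy ν Θ (p t)) (∫ v, Θ' v (p 0 v) * ψ v ∂ν) 0 := by
  obtain ⟨C, hC0, hC⟩ := exists_abs_le_of_continuous h.continuous_deriv (‖p 0‖ + L)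
  have hL0 : 0 ≤ L := by simpa using (norm_nonneg _).trans (hL 1 0)
  have hbd : ∀ t ∈ Metric.ball (0 : ℝ) 1, ∀ v, |p t v| ≤ ‖p 0‖ + L := by
    intro t ht v
    rw [mem_ball_zero_iff, Real.norm_eq_abs] at ht
    have h1 := (p t).norm_coe_le_norm v
    have h2 := norm_le_norm_add_norm_sub' (p t) (p 0)
    have h3 := hL t 0
    rw [sub_zero] at h3
    rw [Real.norm_eq_abs] at h1
    nlinarith
  refine (hasDerivAt_integral_of_dominated_loc_of_lip (bound := fun _ => C * L)
    (Metric.ball_mem_nhds (0 : ℝ) one_pos)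
    (Eventually.of_forall fun t => (continuous_kernel_comp h.continuous (p t)).aestronglyMeasurable)
    (integrable_of_continuous (continuous_kernel_comp h.continuous (p 0)))
    ((continuous_kernel_comp h.continuous_deriv (p 0)).aestronglyMeasurable.mul hψ)
    (Eventually.of_forall fun v => ?_) (integrable_const _) ?_).2
  · refine LipschitzOnWith.of_dist_le_mul fun s hs t ht => ?_
    have h1 := (convex_Icc (-(‖p 0‖ + L)) (‖p 0‖ + L)).norm_image_sub_le_of_norm_hasDerivWithin_le
      (f := Θ v) (f' := Θ' v) (fun x _ => (h.hasDerivAt v x).hasDerivWithinAt)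
      (fun x hx => hC v x (abs_le.2 hx)) (abs_le.1 (hbd t ht v)) (abs_le.1 (hbd s hs v))
    have h2 := ((p s - p t).norm_coe_le_norm v).trans (hL s t)
    rw [ContinuousMap.sub_apply] at h2
    rw [Real.coe_nnabs, abs_of_nonneg (mul_nonneg hC0 hL0), dist_eq_norm, Real.dist_eq, mul_assoc]
    exact h1.trans (mul_le_mul_of_nonneg_left h2 hC0)
  · filter_upwards [hd] with v hv
    exact (h.hasDerivAt v (p 0 v)).comp (0 : ℝ) hv

end

/-! ### Critical points by a barrier method -/

/-- If `P` and `Q` do not increase under the double polar transform, and sublevel sets are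
bounded, the barrier functional `Q + 1 / (c - P)` has a minimiser, which is a critical point
of `Q + τ P` for some `τ > 0`. -/
lemma exists_critical_point [Nonempty (Sph n)] {P Q : C(Sph n, ℝ) → ℝ} (hP : Continuous P)
    (hQ : Continuous Q) (hP' : ∀ k, P (polarLog (polarLog k)) ≤ P k)
    (hQ' : ∀ k, Q (polarLog (polarLog k)) ≤ Q k)
    (hbd : ∀ c M, ∃ R, ∀ k, polarLog (polarLog k) = k → P k ≤ c → Q k ≤ M → ‖k‖ ≤ R) :
    ∃ k, polarLog (polarLog k) = k ∧ ∃ τ > 0, ∀ (φ : C(Sph n, ℝ)) (a b : ℝ),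
      HasDerivAt (fun t : ℝ => P (k + t • φ)) a 0 → HasDerivAt (fun t : ℝ => Q (k + t • φ)) b 0 →
      b + τ * a = 0 := by
  set c := P 0 + 1 with hc
  set M := Q 0 + 1 with hM
  obtain ⟨R, hR⟩ := hbd c M
  -- The condition `Q + 1 / (c - P) ≤ M` multiplied by `c - P` is closed, and it still excludes `P =
  -- c`, where it would read `1 ≤ 0`.
  set X := {k : C(Sph n, ℝ) | polarLog (polarLog k) = k ∧ ‖k‖ ≤ R} ∩
    {k | P k ≤ c ∧ Q k * (c - P k) + 1 ≤ M * (c - P k)} with hX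
  have hXc : IsCompact X := (isCompact_polarLog_fixed R).inter_right
    ((isClosed_le hP continuous_const).inter (isClosed_le
      ((hQ.mul (continuous_const.sub hP)).add continuous_const)
      (continuous_const.mul (continuous_const.sub hP))))
  have hlt : ∀ k ∈ X, P k < c := by
    rintro k ⟨-, h1, h2⟩
    refine h1.lt_of_ne fun h => ?_
    rw [h] at h2
    linarith
  set F : C(Sph n, ℝ) → ℝ := fun k => Q k + (c - P k)⁻¹ with hF
  have hmem : ∀ k, P k < c → F k ≤ M → polarLog (polarLog k) ∈ X := by
    intro k hk hFk
    have hPk := (hP' k).trans_lt hk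
    have h0 : (0 : ℝ) < c - P (polarLog (polarLog k)) := sub_pos.2 hPk
    have h1 : F (polarLog (polarLog k)) ≤ M := by
      refine le_trans (add_le_add (hQ' k) ?_) hFk
      exact inv_anti₀ (sub_pos.2 hk) (sub_le_sub_left (hP' k) c)
    have hfix : polarLog (polarLog (polarLog (polarLog k))) = polarLog (polarLog k) := by
      rw [polarLog_polarLog_polarLog]
    refine ⟨⟨hfix, hR _ hfix hPk.le ?_⟩, hPk.le, ?_⟩
    · exact (le_add_of_nonneg_right (inv_pos.2 h0).le).trans h1
    · have := mul_le_mul_of_nonneg_right h1 h0.le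
      rwa [hF, add_mul, inv_mul_cancel₀ h0.ne'] at this
  have hF0 : F 0 ≤ M := by simp [hF, hc, hM]
  have hXne : X.Nonempty := ⟨_, hmem 0 (by simp [hc]) hF0⟩
  have hFcont : ContinuousOn F X := hQ.continuousOn.add
    ((continuous_const.sub hP).continuousOn.inv₀ fun k hk => (sub_pos.2 (hlt k hk)).ne')
  obtain ⟨k, hkX, hkmin⟩ := hXc.exists_isMinOn hXne hFcont
  have hkM : F k ≤ M := by
    have h0 := sub_pos.2 (hlt k hkX)
    refine le_of_mul_le_mul_right ?_ h0
    rw [hF, add_mul, inv_mul_cancel₀ h0.ne']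
    exact hkX.2.2
  -- Minimality extends beyond fixed points, so arbitrary variations `φ` are allowed.
  have hmin : ∀ j, P j < c → F k ≤ F j := by
    intro j hj
    by_cases hjM : F j ≤ M
    · refine (hkmin (hmem j hj hjM)).trans (add_le_add (hQ' j) ?_)
      exact inv_anti₀ (sub_pos.2 hj) (sub_le_sub_left (hP' j) c)
    · exact hkM.trans (not_le.1 hjM).le
  have hk0 := sub_pos.2 (hlt k hkX)
  -- The multiplier is the derivative of `1 / (c - p)` at `p = P k`.
  refine ⟨k, hkX.1.1, ((c - P k) ^ 2)⁻¹, by positivity, fun φ a b ha hb => ?_⟩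
  have hpath : Continuous fun t : ℝ => k + t • φ := by fun_prop
  have hz : k + (0 : ℝ) • φ = k := by simp
  have hloc : IsLocalMin (fun t : ℝ => F (k + t • φ)) 0 := by
    have hev : ∀ᶠ t in 𝓝 (0 : ℝ), P (k + t • φ) < c :=
      (hP.comp hpath).continuousAt.eventually_lt continuousAt_const
        (by simpa [hz] using hlt k hkX)
    filter_upwards [hev] with t ht
    rw [hz]
    exact hmin _ ht
  have hder := hb.add ((ha.const_sub c).inv (by simpa [hz] using hk0.ne'))
  have := hloc.hasDerivAt_eq_zero hder
  rw [hz] at this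
  rw [← this]
  field_simp

end

section

/-! ### Uniqueness of contact directions and the first variation -/

lemma polarGauge_smul (k : C(Sph n, ℝ)) {t : ℝ} (ht : 0 ≤ t) (x : E n) :
    polarGauge k (t • x) = t * polarGauge k x := by
  simp_rw [polarGauge, Real.mul_iSup_of_nonneg ht, real_inner_smul_left, mul_assoc]

lemma hasDerivAt_energy_add_smul {μ : Measure (Sph n)} [IsFiniteMeasure μ]
    {Θ Θ' : Sph n → ℝ → ℝ} (h : IncreasingKernel Θ Θ') (k φ : C(Sph n, ℝ)) :
    HasDerivAt (fun t : ℝ => energy μ Θ (k + t • φ)) (∫ v, Θ' v (k v) * φ v ∂μ) 0 := by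
  have := hasDerivAt_energy (ν := μ) h (p := fun t : ℝ => k + t • φ) (L := ‖φ‖) (fun s t => ?_)
    (ψ := φ) φ.continuous.aestronglyMeasurable (Eventually.of_forall fun v => ?_)
  · simpa using this
  · rw [add_sub_add_left_eq_sub, ← sub_smul, norm_smul, Real.norm_eq_abs, mul_comm]
  · simpa using ((hasDerivAt_id (0 : ℝ)).mul_const (φ v)).const_add (k v)

variable [Nonempty (Sph n)]

lemma inner_mul_exp_of_mem_contactSet {k : C(Sph n, ℝ)} {ξ v : Sph n} (hv : v ∈ contactSet k ξ) :
    inner ℝ (ξ : E n) (v : E n) * Real.exp (-k v) = polarGauge k ξ := by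
  rw [mem_contactSet.1 hv, ← Real.exp_add, add_neg_cancel_right, exp_polarLog]

/-- A contact direction gives a linear minorant touching the gauge at `ξ`, so the gradient must
equal it. Its norm and direction recover `v`, whence uniqueness. -/
lemma fderiv_polarGauge {k : C(Sph n, ℝ)} {ξ v : Sph n} (hv : v ∈ contactSet k ξ)
    (hd : DifferentiableAt ℝ (polarGauge k) ξ) :
    fderiv ℝ (polarGauge k) ξ = innerSL ℝ (Real.exp (-k v) • (v : E n)) := by
  have hmin : IsLocalMin (fun y : E n => polarGauge k y -
      innerSL ℝ (Real.exp (-k v) • (v : E n)) y) ξ := by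
    refine Eventually.of_forall fun y => ?_
    simp only [innerSL_apply_apply, real_inner_smul_left, real_inner_comm _ (v : E n)]
    have h1 := inner_mul_exp_of_mem_contactSet hv
    have h2 := le_polarGauge k y v
    linarith
  have := hmin.hasFDerivAt_eq_zero (hd.hasFDerivAt.sub (ContinuousLinearMap.hasFDerivAt _))
  exact sub_eq_zero.1 this

lemma contactSet_subsingleton {k : C(Sph n, ℝ)} {ξ : Sph n}
    (hd : DifferentiableAt ℝ (polarGauge k) ξ) : (contactSet k ξ).Subsingleton := by
  intro v hv w hw
  have h1 : Real.exp (-k v) • (v : E n) = Real.exp (-k w) • (w : E n) :=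
    ext_inner_right ℝ fun y => DFunLike.congr_fun
      ((fderiv_polarGauge hv hd).symm.trans (fderiv_polarGauge hw hd)) y
  have h2 := congrArg norm h1
  rw [norm_smul, norm_smul, norm_sph, norm_sph, mul_one, mul_one, Real.norm_eq_abs,
    Real.norm_eq_abs, Real.abs_exp, Real.abs_exp] at h2
  rw [h2] at h1
  exact Subtype.ext (smul_right_injective _ (Real.exp_pos (-k w)).ne' h1)

lemma ae_contactSet_subsingleton (k : C(Sph n, ℝ)) :
    ∀ᵐ ξ ∂sphericalMeasure n, (contactSet k ξ).Subsingleton := by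
  suffices h : ∀ᵐ ξ : Sph n ∂sphericalMeasure n, DifferentiableAt ℝ (polarGauge k) ξ from
    h.mono fun ξ hξ => contactSet_subsingleton hξ
  have hN : MeasurableSet {ξ : Sph n | ¬ DifferentiableAt ℝ (polarGauge k) ξ} :=
    (measurable_subtype_coe (measurableSet_of_differentiableAt ℝ (polarGauge k))).compl
  rw [ae_iff, sphericalMeasure, Measure.toSphere_apply' _ hN]
  refine mul_eq_zero_of_right _ (measure_mono_null ?_
    (ae_iff.1 (lipschitzWith_polarGauge k).ae_differentiableAt))
  -- By homogeneity, differentiability at `t • ξ` forces it at `ξ`, so the cone over the bad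
  -- directions lies in the null set of Rademacher's theorem.
  rintro _ ⟨t, ht, _, ⟨ξ, hξ, rfl⟩, rfl⟩ hd
  refine hξ ?_
  have h1 : polarGauge k = fun y => t⁻¹ * polarGauge k (t • y) := by
    funext y
    rw [polarGauge_smul k ht.1.le, inv_mul_cancel_left₀ ht.1.ne']
  rw [h1]
  exact (DifferentiableAt.comp (ξ : E n) (f := fun y : E n => t • y) hd (by fun_prop)).const_mul _

/-- The contact equation is closed in all its variables, so every cluster point of `w` is a contact
direction of the limit; compactness and uniqueness do the rest. -/
lemma tendsto_of_mem_contactSet {Y : Type*} {l : Filter Y} {κ : Y → C(Sph n, ℝ)}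
    {x w : Y → Sph n} {k : C(Sph n, ℝ)} {ξ v : Sph n} (hκ : Tendsto κ l (𝓝 k))
    (hx : Tendsto x l (𝓝 ξ)) (hw : ∀ y, w y ∈ contactSet (κ y) (x y)) (hv : v ∈ contactSet k ξ)
    (hs : (contactSet k ξ).Subsingleton) : Tendsto w l (𝓝 v) := by
  refine tendsto_nhds_of_unique_mapClusterPt fun u hu => hs ?_ hv
  obtain ⟨U, hU, hwU⟩ := mapClusterPt_iff_ultrafilter.1 hu
  have h1 : Continuous fun p : C(Sph n, ℝ) × Sph n × Sph n =>
      Real.exp (polarLog p.1 p.2.1 + p.1 p.2.2) := by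
    have := continuous_polarLog (n := n)
    fun_prop
  have h2 : Continuous fun p : C(Sph n, ℝ) × Sph n × Sph n =>
      inner ℝ (p.2.1 : E n) (p.2.2 : E n) := by fun_prop
  have h3 := (hκ.mono_left hU).prodMk_nhds ((hx.mono_left hU).prodMk_nhds hwU)
  exact tendsto_nhds_unique ((h2.tendsto _).comp h3)
    (((h1.tendsto _).comp h3).congr fun y => (hw y).symm)

/-- Envelope argument: comparing the optimal directions `w t` and `v` traps the increment between
`-t * φ v` and `-t * φ (w t)`, and `w t` tends to `v`. -/
lemma hasDerivAt_polarLog {k : C(Sph n, ℝ)} {ξ v : Sph n} (hv : v ∈ contactSet k ξ)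
    (hs : (contactSet k ξ).Subsingleton) (φ : C(Sph n, ℝ)) :
    HasDerivAt (fun t : ℝ => polarLog (k + t • φ) ξ) (-φ v) 0 := by
  choose w hw using fun t : ℝ => contactSet_nonempty (k + t • φ) ξ
  have hpath : Tendsto (fun t : ℝ => k + t • φ) (𝓝 0) (𝓝 k) := by
    have : Continuous fun t : ℝ => k + t • φ := by fun_prop
    simpa using this.tendsto 0
  have hlim := (φ.continuous.tendsto v).comp
    (tendsto_of_mem_contactSet hpath tendsto_const_nhds hw hv hs)
  rw [hasDerivAt_iff_isLittleO, Asymptotics.isLittleO_iff]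
  intro ε hε
  filter_upwards [Metric.tendsto_nhds.1 hlim ε hε] with t ht
  have h1 := add_le_add_of_mem_contactSet (hw t) k
  have h2 := add_le_add_of_mem_contactSet hv (k + t • φ)
  simp only [ContinuousMap.add_apply, ContinuousMap.smul_apply, smul_eq_mul] at h1 h2
  rw [Function.comp_apply, Real.dist_eq] at ht
  simp only [zero_smul, add_zero, sub_zero, smul_eq_mul, Real.norm_eq_abs]
  have h3 : |t * (φ (w t) - φ v)| ≤ ε * |t| := by
    rw [abs_mul, mul_comm]
    exact mul_le_mul_of_nonneg_right ht.le (abs_nonneg t)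
  have h4 := abs_le.1 h3
  have h5 : 0 ≤ ε * |t| := by positivity
  rw [abs_le]
  constructor <;> linarith

lemma aemeasurable_of_ae_continuousAt {X Y : Type*} [TopologicalSpace X] [MeasurableSpace X]
    [OpensMeasurableSpace X] [PseudoMetricSpace Y] [MeasurableSpace Y] [BorelSpace Y]
    {f : X → Y} {ν : Measure X} (h : ∀ᵐ x ∂ν, ContinuousAt f x) : AEMeasurable f ν := by
  have hs : MeasurableSet {x | ContinuousAt f x} := (IsGδ.setOfPred_continuousAt f).measurableSet
  have hc : ContinuousOn f {x | ContinuousAt f x} := fun x hx => ContinuousAt.continuousWithinAt hx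
  have := hc.aemeasurable hs (μ := ν)
  rwa [Measure.restrict_eq_self_of_ae_mem (s := {x | ContinuousAt f x}) h] at this

/-- Any selection of contact directions is continuous wherever the direction is unique, so no
measurable selection theorem is needed. -/
lemma aemeasurable_of_mem_contactSet {k : C(Sph n, ℝ)} {α : Sph n → Sph n}
    (hα : ∀ ξ, α ξ ∈ contactSet k ξ) {lam : Measure (Sph n)} (hlam : lam ≪ sphericalMeasure n) :
    AEMeasurable α lam :=
  aemeasurable_of_ae_continuousAt <| ((ae_contactSet_subsingleton k).filter_mono hlam.ae_le).mono
    fun ξ hξ => tendsto_of_mem_contactSet (κ := fun _ => k) (x := id) tendsto_const_nhds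
      tendsto_id hα (hα ξ) hξ

/-- The first variation of the energy of the polar transform. -/
lemma hasDerivAt_energy_polarLog {lam : Measure (Sph n)} [IsFiniteMeasure lam]
    (hlam : lam ≪ sphericalMeasure n) {Θ Θ' : Sph n → ℝ → ℝ} (h : IncreasingKernel Θ Θ')
    {k : C(Sph n, ℝ)} {α : Sph n → Sph n} (hα : ∀ ξ, α ξ ∈ contactSet k ξ) (φ : C(Sph n, ℝ)) :
    HasDerivAt (fun t : ℝ => energy lam Θ (polarLog (k + t • φ)))
      (-∫ ξ, Θ' ξ (polarLog k ξ) * φ (α ξ) ∂lam) 0 := by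
  have hm : AEStronglyMeasurable (fun ξ => -φ (α ξ)) lam :=
    (φ.continuous.measurable.comp_aemeasurable
      (aemeasurable_of_mem_contactSet hα hlam)).neg.aestronglyMeasurable
  have := hasDerivAt_energy (ν := lam) h (p := fun t : ℝ => polarLog (k + t • φ)) (L := ‖φ‖)
    (fun s t => ?_) hm (((ae_contactSet_subsingleton k).filter_mono hlam.ae_le).mono fun ξ hξ =>
      hasDerivAt_polarLog (hα ξ) hξ φ)
  · simpa [integral_neg] using this
  · have h1 := lipschitzWith_polarLog.dist_le_mul (k + s • φ) (k + t • φ)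
    rw [NNReal.coe_one, one_mul, dist_eq_norm, dist_eq_norm, add_sub_add_left_eq_sub, ← sub_smul,
      norm_smul, Real.norm_eq_abs, mul_comm] at h1
    exact h1

/-! ### The Euler-Lagrange equation -/

lemma polarLog_ge_neg {k : C(Sph n, ℝ)} {R : ℝ} (h : ∀ v, k v ≤ R) (ξ : Sph n) :
    -R ≤ polarLog k ξ := by
  linarith [polarLog_add_nonneg k ξ, h ξ]

/-- Coercivity of a pair of energies, one of which has a nonnegative kernel, along a function
and its polar transform. -/
lemma exists_bound_of_energy_le {μ ν : Measure (Sph n)} [IsFiniteMeasure μ] [IsFiniteMeasure ν]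
    (hμ : NotConcentratedOnHemisphere μ) (hν : NotConcentratedOnHemisphere ν)
    {Θ Θ' Λ Λ' : Sph n → ℝ → ℝ} (hΘ : IncreasingKernel Θ Θ') (hΛ : IncreasingKernel Λ Λ')
    (hΘb : ∀ v, Tendsto (Θ v) atTop atTop) (hΛb : ∀ v, Tendsto (Λ v) atTop atTop)
    (hpos : ∀ v s, 0 ≤ Θ v s) (c M : ℝ) :
    ∃ R, ∀ k, polarLog (polarLog k) = k → energy μ Θ k ≤ c → energy ν Λ (polarLog k) ≤ M →
      ‖k‖ ≤ R := by
  obtain ⟨R₁, hR₁⟩ := exists_forall_le_of_energy_le hμ hΘ hΘb c 0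
  obtain ⟨C, -, hC⟩ := exists_abs_le_of_continuous hΛ.continuous |R₁|
  obtain ⟨R₂, hR₂⟩ := exists_forall_le_of_energy_le hν hΛ hΛb M C
  refine ⟨max |R₁| |R₂|, fun k hk hc hM => ?_⟩
  have h1 := hR₁ k hk hc fun v => by simpa using hpos v (k v)
  -- The upper bound on `k` bounds `polarLog k` below, hence also `Λ`. Coercivity then applies to
  -- `polarLog k`, and its upper bound is a lower bound on `k`.
  have h2 := polarLog_ge_neg h1
  have h3 := hR₂ (polarLog k) (by rw [polarLog_polarLog_polarLog]) hM fun ξ =>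
    (abs_le.1 (hC ξ (-R₁) (abs_neg R₁).le)).1.trans (hΛ.monotone ξ (h2 ξ))
  have h4 := polarLog_ge_neg h3
  rw [hk] at h4
  rw [ContinuousMap.norm_le _ (by positivity)]
  intro v
  rw [Real.norm_eq_abs, abs_le]
  exact ⟨by linarith [h4 v, le_max_right |R₁| |R₂|, le_abs_self R₂],
    by linarith [h1 v, le_max_left |R₁| |R₂|, le_abs_self R₁]⟩

/-- Existence of a solution of the Euler-Lagrange equation. -/
lemma exists_euler_lagrange {lam μ : Measure (Sph n)} [IsFiniteMeasure lam] [IsFiniteMeasure μ]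
    (hac : lam ≪ sphericalMeasure n) (hlam : NotConcentratedOnHemisphere lam)
    (hμ : NotConcentratedOnHemisphere μ) {Γ Γ' Θ Θ' : Sph n → ℝ → ℝ}
    (hΓ : IncreasingKernel Γ Γ') (hΘ : IncreasingKernel Θ Θ')
    (hΓb : ∀ v, Tendsto (Γ v) atTop atTop) (hΘb : ∀ v, Tendsto (Θ v) atTop atTop)
    (hpos : (∀ v s, 0 ≤ Γ v s) ∨ ∀ v s, 0 ≤ Θ v s) :
    ∃ k, polarLog (polarLog k) = k ∧ ∃ τ > 0, ∀ α : Sph n → Sph n, (∀ ξ, α ξ ∈ contactSet k ξ) →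
      ∀ φ : C(Sph n, ℝ), ∫ v, Θ' v (k v) * φ v ∂μ =
        τ * ∫ ξ, Γ' ξ (polarLog k ξ) * φ (α ξ) ∂lam := by
  have hAc : Continuous fun k => energy lam Γ (polarLog k) :=
    (continuous_energy hΓ.continuous).comp continuous_polarLog
  have hBc := continuous_energy (ν := μ) hΘ.continuous
  have hA : ∀ k, energy lam Γ (polarLog (polarLog (polarLog k))) ≤ energy lam Γ (polarLog k) :=
    fun k => by rw [polarLog_polarLog_polarLog]
  have hB : ∀ k, energy μ Θ (polarLog (polarLog k)) ≤ energy μ Θ k :=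
    fun k => energy_mono hΘ (polarLog_polarLog_le k)
  -- The energy with nonnegative kernel takes the role of `P`, because coercivity must start from
  -- it; exchanging roles inverts the multiplier.
  rcases hpos with hpos | hpos
  · obtain ⟨k, hk, τ, hτ, hcrit⟩ := exists_critical_point hAc hBc hA hB fun c M => by
      obtain ⟨R, hR⟩ := exists_bound_of_energy_le hlam hμ hΓ hΘ hΓb hΘb hpos c M
      refine ⟨R, fun k hk h1 h2 => ?_⟩
      have h3 := hR (polarLog k) (by rw [polarLog_polarLog_polarLog]) h1 (by rwa [hk])
      have h4 := norm_polarLog_le (polarLog k)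
      rw [hk] at h4
      exact h4.trans h3
    refine ⟨k, hk, τ, hτ, fun α hα φ => ?_⟩
    have := hcrit φ _ _ (hasDerivAt_energy_polarLog hac hΓ hα φ) (hasDerivAt_energy_add_smul hΘ k φ)
    linarith
  · obtain ⟨k, hk, τ, hτ, hcrit⟩ := exists_critical_point hBc hAc hB hA
      (exists_bound_of_energy_le hμ hlam hΘ hΓ hΘb hΓb hpos)
    refine ⟨k, hk, τ⁻¹, inv_pos.2 hτ, fun α hα φ => ?_⟩
    have := hcrit φ _ _ (hasDerivAt_energy_add_smul hΘ k φ) (hasDerivAt_energy_polarLog hac hΓ hα φ)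
    rw [eq_inv_mul_iff_mul_eq₀ hτ.ne']
    linarith

/-- The Euler-Lagrange equation as an identity of measures. -/
lemma measureReal_eq_of_euler_lagrange {lam μ : Measure (Sph n)} [IsFiniteMeasure lam]
    [IsFiniteMeasure μ] (hac : lam ≪ sphericalMeasure n) {Γ Γ' Θ Θ' : Sph n → ℝ → ℝ}
    (hΓ : IncreasingKernel Γ Γ') (hΘ : IncreasingKernel Θ Θ') {k : C(Sph n, ℝ)} {τ : ℝ}
    (hτ : 0 < τ) {α : Sph n → Sph n} (hα : ∀ ξ, α ξ ∈ contactSet k ξ)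
    (hEL : ∀ φ : C(Sph n, ℝ), ∫ v, Θ' v (k v) * φ v ∂μ =
        τ * ∫ ξ, Γ' ξ (polarLog k ξ) * φ (α ξ) ∂lam) {ω : Set (Sph n)} (hω : MeasurableSet ω) :
    μ.real ω =
      τ * ∫ ξ in α ⁻¹' ω, Γ' ξ (polarLog k ξ) / Θ' (α ξ) (k (α ξ)) ∂lam := by
  have hαm := aemeasurable_of_mem_contactSet hα hac
  have hΓc := continuous_kernel_comp hΓ.continuous_deriv (polarLog k)
  have hΘc := continuous_kernel_comp hΘ.continuous_deriv k
  have hΘi : Continuous fun v => (Θ' v (k v))⁻¹ := hΘc.inv₀ fun v => (hΘ.deriv_pos v _).ne'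
  set D : Sph n → ℝ := fun ξ => Γ' ξ (polarLog k ξ) / Θ' (α ξ) (k (α ξ)) with hD
  have hDpos : ∀ ξ, 0 ≤ τ * D ξ := fun ξ =>
    mul_nonneg hτ.le (div_pos (hΓ.deriv_pos _ _) (hΘ.deriv_pos _ _)).le
  have hDint : Integrable (fun ξ => τ * D ξ) lam := by
    obtain ⟨C, hC⟩ := isCompact_univ.exists_bound_of_continuousOn hΘi.continuousOn
    refine Integrable.const_mul ?_ τ
    simp only [hD, div_eq_mul_inv]
    exact (integrable_of_continuous hΓc).mul_bdd (c := C)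
      (hΘi.measurable.comp_aemeasurable hαm).aestronglyMeasurable
      (Eventually.of_forall fun ξ => hC (α ξ) (mem_univ _))
  have hDm : AEMeasurable (fun ξ => ENNReal.ofReal (τ * D ξ)) lam :=
    hDint.aemeasurable.ennreal_ofReal
  have hfin : IsFiniteMeasure (lam.withDensity fun ξ => ENNReal.ofReal (τ * D ξ)) :=
    isFiniteMeasure_withDensity_ofReal hDint.2
  have hαm' : AEMeasurable α (lam.withDensity fun ξ => ENNReal.ofReal (τ * D ξ)) :=
    hαm.mono_ac (withDensity_absolutelyContinuous _ _)
  have key : μ = (lam.withDensity fun ξ => ENNReal.ofReal (τ * D ξ)).map α := by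
    refine ext_of_forall_integral_eq_of_IsFiniteMeasure fun f => ?_
    rw [integral_map hαm' f.continuous.aestronglyMeasurable,
      integral_withDensity_eq_integral_toReal_smul₀ hDm
        (Eventually.of_forall fun ξ => ENNReal.ofReal_lt_top)]
    -- Testing with `f / Θ'` isolates `∫ f dμ`.
    have h1 := hEL ⟨fun v => (Θ' v (k v))⁻¹ * f v, hΘi.mul f.continuous⟩
    simp only [ContinuousMap.coe_mk] at h1
    rw [← integral_const_mul] at h1
    calc ∫ v, f v ∂μ = ∫ v, Θ' v (k v) * ((Θ' v (k v))⁻¹ * f v) ∂μ :=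
          integral_congr_ae (Eventually.of_forall fun v =>
            (mul_inv_cancel_left₀ (hΘ.deriv_pos v _).ne' _).symm)
      _ = _ := h1
      _ = _ := integral_congr_ae (Eventually.of_forall fun ξ => by
            change _ = (ENNReal.ofReal (τ * D ξ)).toReal • f (α ξ)
            rw [ENNReal.toReal_ofReal (hDpos ξ), hD, smul_eq_mul]
            ring)
  have hωm : NullMeasurableSet (α ⁻¹' ω) lam := hαm.nullMeasurable hω
  have h2 : μ ω = ∫⁻ ξ in α ⁻¹' ω, ENNReal.ofReal (τ * D ξ) ∂lam := by
    conv_lhs => rw [key]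
    rw [Measure.map_apply_of_aemeasurable hαm' hω, withDensity_apply₀ _ hωm]
  rw [measureReal_def, h2, ← integral_const_mul, integral_eq_lintegral_of_nonneg_ae
    (Eventually.of_forall hDpos) hDint.aestronglyMeasurable.restrict]

end

section

/-! ### Kernels from the classes `𝒞_d` and `𝒢_d` -/

lemma ClassGd.toClassCd {G : Sph n → ℝ → ℝ} (h : ClassGd G) : ClassCd G :=
  ⟨h.toClassC, h.deriv_neg⟩

/-- The chain rule for `t = exp (-s)` produces `-t * G_t`, the factor in the density of the measure;
the two signs cancel in the quotient. -/
lemma ClassCd.increasingKernel {G : Sph n → ℝ → ℝ} (h : ClassCd G) :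
    IncreasingKernel (fun v s => G v (Real.exp (-s)))
      (fun v s => -(Real.exp (-s) * deriv (G v) (Real.exp (-s)))) := by
  have hc : Continuous fun p : Sph n × ℝ => (p.1, Real.exp (-p.2)) := by fun_prop
  have hmem : ∀ p : Sph n × ℝ, (p.1, Real.exp (-p.2)) ∈ (univ : Set (Sph n)) ×ˢ Ioi (0 : ℝ) :=
    fun p => ⟨mem_univ _, Real.exp_pos _⟩
  refine ⟨h.continuousOn.comp_continuous hc hmem, ?_, fun v s => ?_, fun v s => ?_⟩
  · have h1 : Continuous fun p : Sph n × ℝ => deriv (G p.1) (Real.exp (-p.2)) :=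
      h.continuousOn_deriv.comp_continuous hc hmem
    fun_prop
  · have h1 : HasDerivAt (fun s : ℝ => Real.exp (-s)) (-Real.exp (-s)) s := by
      simpa using (hasDerivAt_neg s).exp
    have h2 := (h.differentiableAt v _ (Real.exp_pos (-s))).hasDerivAt.comp s h1
    exact h2.congr_deriv (by ring)
  · exact neg_pos.2 (mul_neg_of_pos_of_neg (Real.exp_pos _) (h.deriv_neg v _ (Real.exp_pos _)))

lemma BlowsUpAtZero.tendsto_exp_neg {G : Sph n → ℝ → ℝ} (h : BlowsUpAtZero G) (v : Sph n) :
    Tendsto (fun s => G v (Real.exp (-s))) atTop atTop :=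
  (h v).comp (tendsto_nhdsWithin_iff.2 ⟨Real.tendsto_exp_neg_atTop_nhds_zero,
    Eventually.of_forall fun s => Real.exp_pos (-s)⟩)

/-! ### Wulff shapes -/

/-- The Wulff shape of `exp k`. -/
def wulffShape (k : C(Sph n, ℝ)) : Set (E n) :=
  {x | ∀ v : Sph n, inner ℝ x (v : E n) ≤ Real.exp (k v)}

lemma exists_smul_eq [Nonempty (Sph n)] (x : E n) : ∃ ξ : Sph n, ‖x‖ • (ξ : E n) = x := by
  rcases eq_or_ne x 0 with rfl | hx
  · exact ⟨Classical.arbitrary _, by simp⟩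
  · have h0 : ‖x‖ ≠ 0 := norm_ne_zero_iff.2 hx
    refine ⟨⟨‖x‖⁻¹ • x, by simp [norm_smul, h0]⟩, ?_⟩
    rw [smul_smul, mul_inv_cancel₀ h0, one_smul]

lemma isClosed_wulffShape (k : C(Sph n, ℝ)) : IsClosed (wulffShape k) := by
  have : wulffShape k = ⋂ v : Sph n, {x | inner ℝ x (v : E n) ≤ Real.exp (k v)} := by
    ext x
    simp [wulffShape]
  rw [this]
  exact isClosed_iInter fun v => isClosed_le (by fun_prop) continuous_const

lemma wulffShape_mem_convexBodiesO [Nonempty (Sph n)] (k : C(Sph n, ℝ)) :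
    wulffShape k ∈ convexBodiesO n := by
  refine ⟨fun x hx y hy a b ha hb hab v => ?_, ?_, ?_⟩
  · rw [inner_add_left, real_inner_smul_left, real_inner_smul_left]
    calc _ ≤ a * Real.exp (k v) + b * Real.exp (k v) :=
          add_le_add (mul_le_mul_of_nonneg_left (hx v) ha) (mul_le_mul_of_nonneg_left (hy v) hb)
      _ = _ := by rw [← add_mul, hab, one_mul]
  · refine Metric.isCompact_of_isClosed_isBounded (isClosed_wulffShape k)
      ((Metric.isBounded_closedBall (x := (0 : E n)) (r := Real.exp ‖k‖)).subset fun x hx => ?_)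
    obtain ⟨ξ, hξ⟩ := exists_smul_eq x
    have h1 := hx ξ
    rw [← hξ, real_inner_smul_left, inner_self_sph, mul_one] at h1
    rw [mem_closedBall_zero_iff]
    exact h1.trans (Real.exp_le_exp.2 ((le_abs_self _).trans (k.norm_coe_le_norm ξ)))
  · refine mem_interior.2 ⟨Metric.ball 0 (Real.exp (-‖k‖)), fun x hx v => ?_, Metric.isOpen_ball,
      Metric.mem_ball_self (Real.exp_pos _)⟩
    rw [mem_ball_zero_iff] at hx
    have h1 : inner ℝ x (v : E n) ≤ ‖x‖ := by simpa [norm_sph] using real_inner_le_norm x (v : E n)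
    exact h1.trans (hx.le.trans (Real.exp_le_exp.2 (abs_le.1 (k.norm_coe_le_norm v)).1))

lemma le_exp_neg_iff {t a : ℝ} : t ≤ Real.exp (-a) ↔ t * Real.exp a ≤ 1 := by
  rw [Real.exp_neg, ← one_div, le_div_iff₀ (Real.exp_pos a)]

variable [Nonempty (Sph n)]

lemma smul_mem_wulffShape (k : C(Sph n, ℝ)) {t : ℝ} (ht : 0 ≤ t) (ξ : Sph n) :
    t • (ξ : E n) ∈ wulffShape k ↔ t ≤ Real.exp (-polarLog k ξ) := by
  rw [le_exp_neg_iff]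
  constructor
  · intro h
    obtain ⟨v, hv⟩ := contactSet_nonempty k ξ
    have h1 := h v
    rw [real_inner_smul_left, mem_contactSet.1 hv, Real.exp_add, ← mul_assoc] at h1
    exact (mul_le_iff_le_one_left (Real.exp_pos _)).1 h1
  · intro h v
    rw [real_inner_smul_left]
    calc _ ≤ t * Real.exp (polarLog k ξ + k v) := mul_le_mul_of_nonneg_left (inner_le_exp k ξ v) ht
      _ = t * Real.exp (polarLog k ξ) * Real.exp (k v) := by rw [Real.exp_add, mul_assoc]
      _ ≤ _ := mul_le_of_le_one_left (Real.exp_pos _).le h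

lemma radialFun_wulffShape (k : C(Sph n, ℝ)) (ξ : Sph n) :
    radialFun (wulffShape k) ξ = Real.exp (-polarLog k ξ) := by
  have : {t : ℝ | 0 ≤ t ∧ t • (ξ : E n) ∈ wulffShape k} = Icc 0 (Real.exp (-polarLog k ξ)) :=
    ext fun t => and_congr_right fun ht => smul_mem_wulffShape k ht ξ
  rw [radialFun, this, csSup_Icc (Real.exp_pos _).le]

/-! ### Support function, polar body and Gauss maps of the Wulff shape of a fixed point -/

section

variable {k : C(Sph n, ℝ)} (hk : polarLog (polarLog k) = k)
include hk

/-- For a general `k` the support function may lie below `exp k`. The fixed-point hypothesis makes a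
contact direction of `polarLog k` at `v` yield a boundary point attaining the bound. -/
lemma isGreatest_support_wulffShape (v : Sph n) :
    IsGreatest ((fun y : E n => inner ℝ (v : E n) y) '' wulffShape k) (Real.exp (k v)) := by
  constructor
  · obtain ⟨ξ, hξ⟩ := contactSet_nonempty (polarLog k) v
    refine ⟨Real.exp (-polarLog k ξ) • (ξ : E n),
      (smul_mem_wulffShape k (Real.exp_pos _).le ξ).2 le_rfl, ?_⟩
    rw [mem_contactSet, hk] at hξ
    simp only [real_inner_smul_right, hξ, ← Real.exp_add]
    ring_nf
  · rintro _ ⟨y, hy, rfl⟩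
    exact (real_inner_comm y (v : E n)).trans_le (hy v)

lemma supportFun_wulffShape (v : Sph n) : supportFun (wulffShape k) v = Real.exp (k v) :=
  (isGreatest_support_wulffShape hk v).csSup_eq

lemma radialFun_polarBody_wulffShape (v : Sph n) :
    radialFun (polarBody (wulffShape k)) v = Real.exp (-k v) := by
  have : {t : ℝ | 0 ≤ t ∧ t • (v : E n) ∈ polarBody (wulffShape k)} = Icc 0 (Real.exp (-k v)) := by
    refine ext fun t => and_congr_right fun ht => ?_
    obtain ⟨⟨y, hy, hyv⟩, hmax⟩ := isGreatest_support_wulffShape hk v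
    rw [le_exp_neg_iff]
    refine ⟨fun h => ?_, fun h z hz => ?_⟩
    · simpa only [real_inner_smul_left, hyv] using h y hy
    · rw [real_inner_smul_left]
      exact (mul_le_mul_of_nonneg_left (hmax ⟨z, hz, rfl⟩) ht).trans h
  rw [radialFun, this, csSup_Icc (Real.exp_pos _).le]

lemma radialGaussImage_wulffShape (ξ : Sph n) :
    radialGaussImage (wulffShape k) ξ = contactSet k ξ := by
  ext v
  change inner ℝ (radialFun (wulffShape k) ξ • (ξ : E n)) (v : E n) = supportFun _ _ ↔ _
  rw [radialFun_wulffShape, supportFun_wulffShape hk, real_inner_smul_left, mem_contactSet,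
    Real.exp_neg, inv_mul_eq_iff_eq_mul₀ (Real.exp_pos _).ne', Real.exp_add]

lemma radialGaussMap_mem_contactSet (ξ : Sph n) :
    radialGaussMap (wulffShape k) ξ ∈ contactSet k ξ := by
  rw [← radialGaussImage_wulffShape hk]
  refine Classical.epsilon_spec (p := fun v => v ∈ radialGaussImage (wulffShape k) ξ) ?_
  rw [radialGaussImage_wulffShape hk]
  exact contactSet_nonempty k ξ

lemma mem_reverseRadialGaussImage_wulffShape {ω : Set (Sph n)} {ξ : Sph n} :
    ξ ∈ reverseRadialGaussImage (wulffShape k) ω ↔ ∃ v ∈ ω, v ∈ contactSet k ξ := by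
  refine exists_congr fun v => and_congr_right fun _ => ?_
  rw [← radialGaussImage_wulffShape hk ξ]
  change (∃ x, (x ∈ frontier (wulffShape k) ∧ inner ℝ x (v : E n) = supportFun (wulffShape k) v) ∧
    ‖x‖⁻¹ • x = (ξ : E n)) ↔ inner ℝ (radialFun (wulffShape k) ξ • (ξ : E n)) (v : E n) =
      supportFun (wulffShape k) v
  rw [supportFun_wulffShape hk, radialFun_wulffShape]
  constructor
  · rintro ⟨x, ⟨hx, hxv⟩, hxξ⟩
    have hx0 : ‖x‖ ≠ 0 := by
      intro h
      have := norm_sph ξ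
      simp [← hxξ, h] at this
    have hxe : x = ‖x‖ • (ξ : E n) := by rw [← hxξ, smul_inv_smul₀ hx0]
    have hxK : ‖x‖ • (ξ : E n) ∈ wulffShape k := hxe ▸ (isClosed_wulffShape k).frontier_subset hx
    have h1 := (smul_mem_wulffShape k (norm_nonneg x) ξ).1 hxK
    have hin : 0 ≤ inner ℝ (ξ : E n) (v : E n) := by
      rw [← hxξ, real_inner_smul_left, hxv]
      positivity
    have h2 := (smul_mem_wulffShape k (Real.exp_pos (-polarLog k ξ)).le ξ).2 le_rfl v
    refine le_antisymm h2 ?_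
    rw [← hxv, hxe, real_inner_smul_left, real_inner_smul_left]
    exact mul_le_mul_of_nonneg_right h1 hin
  · intro h
    have hpos := Real.exp_pos (-polarLog k ξ)
    refine ⟨_, ⟨⟨subset_closure ((smul_mem_wulffShape k hpos.le ξ).2 le_rfl), fun hint => ?_⟩, h⟩, ?_⟩
    · have hc : Tendsto (fun t : ℝ => t • (Real.exp (-polarLog k ξ) • (ξ : E n))) (𝓝 1)
          (𝓝 (Real.exp (-polarLog k ξ) • (ξ : E n))) := by
        have : Continuous fun t : ℝ => t • (Real.exp (-polarLog k ξ) • (ξ : E n)) := by fun_prop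
        simpa using this.tendsto 1
      have hev : ∀ᶠ t : ℝ in 𝓝[>] 1,
          t • (Real.exp (-polarLog k ξ) • (ξ : E n)) ∈ wulffShape k :=
        (hc.eventually (mem_interior_iff_mem_nhds.1 hint)).filter_mono nhdsWithin_le_nhds
      obtain ⟨t, ht, ht1⟩ := (hev.and self_mem_nhdsWithin).exists
      have h3 := ht v
      rw [real_inner_smul_left, h] at h3
      exact absurd ((mul_le_iff_le_one_left (Real.exp_pos _)).1 h3) (not_le.2 ht1)
    · rw [norm_smul, norm_sph, mul_one, Real.norm_eq_abs, abs_of_pos hpos, inv_smul_smul₀ hpos.ne']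

end

lemma polarGaussImageMeasure_wulffShape {G Ψ : Sph n → ℝ → ℝ} {lam : Measure (Sph n)}
    (hac : lam ≪ sphericalMeasure n) {k : C(Sph n, ℝ)} (hk : polarLog (polarLog k) = k)
    (ω : Set (Sph n)) :
    polarGaussImageMeasure G Ψ lam (wulffShape k) ω =
      ∫ ξ in radialGaussMap (wulffShape k) ⁻¹' ω,
        -(Real.exp (-polarLog k ξ) * deriv (G ξ) (Real.exp (-polarLog k ξ))) /
        -(Real.exp (-k (radialGaussMap (wulffShape k) ξ)) *
          deriv (Ψ (radialGaussMap (wulffShape k) ξ))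
            (Real.exp (-k (radialGaussMap (wulffShape k) ξ)))) ∂lam := by
  -- The two sets can differ only where the contact direction is not unique, which is a null set.
  have hae : reverseRadialGaussImage (wulffShape k) ω =ᵐ[lam]
      radialGaussMap (wulffShape k) ⁻¹' ω := by
    refine eventuallyEq_set.2 (((ae_contactSet_subsingleton k).filter_mono hac.ae_le).mono
      fun ξ hξ => ?_)
    have hα := radialGaussMap_mem_contactSet hk ξ
    rw [mem_reverseRadialGaussImage_wulffShape hk]
    exact ⟨fun ⟨v, hv, hvξ⟩ => mem_preimage.2 (hξ hα hvξ ▸ hv), fun h => ⟨_, h, hα⟩⟩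
  rw [polarGaussImageMeasure, setIntegral_congr_set hae]
  refine integral_congr_ae (Eventually.of_forall fun ξ => ?_)
  simp only [polarDensity, radialFun_wulffShape, radialFun_polarBody_wulffShape hk, neg_div_neg_eq]

end

end MusielakOrlicz

/-! ### Proof of the theorem -/

theorem mainTheorem3 (n : ℕ) (hn : 2 ≤ n)
    (lam μ : Measure (MusielakOrlicz.Sph n)) [IsFiniteMeasure μ]
    (hlam : MusielakOrlicz.ClassM lam) (hμ : μ ≠ 0)
    (hlam' : MusielakOrlicz.NotConcentratedOnHemisphere lam)
    (hμ' : MusielakOrlicz.NotConcentratedOnHemisphere μ)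
    (G Ψ : MusielakOrlicz.Sph n → ℝ → ℝ)
    (hGΨ :
      (MusielakOrlicz.ClassCd Ψ ∧ MusielakOrlicz.BlowsUpAtZero Ψ ∧ MusielakOrlicz.ClassGd G) ∨
      (MusielakOrlicz.ClassCd G ∧ MusielakOrlicz.BlowsUpAtZero G ∧ MusielakOrlicz.ClassGd Ψ)) :
    ∃ K ∈ MusielakOrlicz.convexBodiesO n,
      MusielakOrlicz.polarGaussImageMeasure G Ψ lam K univ ≠ 0 ∧
      ∀ ω : Set (MusielakOrlicz.Sph n), MeasurableSet ω →
        μ.real ω / μ.real univ =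
          MusielakOrlicz.polarGaussImageMeasure G Ψ lam K ω /
            MusielakOrlicz.polarGaussImageMeasure G Ψ lam K univ := by
  open MusielakOrlicz in
  have hne : Nonempty (Sph n) := by
    by_contra h
    rw [not_nonempty_iff] at h
    exact hμ (Measure.eq_zero_of_isEmpty μ)
  have := hlam.isFinite
  have hac := hlam.absolutelyContinuous
  obtain ⟨hG, hGb, hΨ, hΨb, hpos⟩ : ClassCd G ∧ BlowsUpAtZero G ∧ ClassCd Ψ ∧ BlowsUpAtZero Ψ ∧
      ((∀ v s, 0 ≤ G v (Real.exp (-s))) ∨ ∀ v s, 0 ≤ Ψ v (Real.exp (-s))) := by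
    rcases hGΨ with ⟨h1, h2, h3⟩ | ⟨h1, h2, h3⟩
    · exact ⟨h3.toClassCd, h3.tendsto_zero, h1, h2,
        Or.inl fun v s => (h3.pos v _ (Real.exp_pos _)).le⟩
    · exact ⟨h1, h2, h3.toClassCd, h3.tendsto_zero,
        Or.inr fun v s => (h3.pos v _ (Real.exp_pos _)).le⟩
  obtain ⟨k, hk, τ, hτ, hEL⟩ := exists_euler_lagrange hac hlam' hμ' hG.increasingKernel
    hΨ.increasingKernel hGb.tendsto_exp_neg hΨb.tendsto_exp_neg hpos
  have hα := radialGaussMap_mem_contactSet hk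
  have key : ∀ ω, MeasurableSet ω →
      μ.real ω = τ * polarGaussImageMeasure G Ψ lam (wulffShape k) ω := fun ω hω => by
    rw [polarGaussImageMeasure_wulffShape hac hk]
    exact measureReal_eq_of_euler_lagrange hac hG.increasingKernel hΨ.increasingKernel hτ hα
      (hEL _ hα) hω
  have huniv : μ.real univ ≠ 0 := by
    rwa [Ne, measureReal_eq_zero_iff, Measure.measure_univ_eq_zero]
  refine ⟨wulffShape k, wulffShape_mem_convexBodiesO k, fun h => huniv ?_, fun ω hω => ?_⟩
  · rw [key _ MeasurableSet.univ, h, mul_zero]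
  · rw [key ω hω, key _ MeasurableSet.univ, mul_div_mul_left _ _ hτ.ne']
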